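/- Let $k\ge 1$ be an integer, $\lambda>0$, and let $H$ be a cumulative distribution function on $\mathbb{R}$. Let $\{N(t)\}_{t\ge 0}$ be a Poisson process with rate $k\lambda$, let $X_1,X_2,\dots$ be i.i.d. random variables, uniform on $\{1,\dots,k\}$ and independent of $\{N(t)\}_{t\ge0}$, and put $N^{(k)}(t)=\sum_{i=1}^{N(t)}X_i$. Let $Y,Y_1,Y_2,\dots$ be i.i.d. real random variables with distribution function $H$, the sequence $(Y_i)_{i\ge1}$ being independent of the process $\{N^{(k)}(t)\}_{t\ge0}$, and put $Z(t)=\sum_{i=1}^{N^{(k)}(t)}Y_i$, $t\ge 0$ (the compound Poisson process of order $k$). Let $c_1,c_2\ge 0$ with $c_1+c_2=1$, $\mu_1,\mu_2>0$ and $\alpha_1,\alpha_2\in(0,1)$, and let $\{S(t)\}_{t\ge0}$ be the mixture of tempered stable subordinators with these parameters, i.e. the non-decreasing Lévy process with $$\mathbb{E}\big[e^{-uS(t)}\big]=\exp\Big\{-t\Big(c_1\big((u+\mu_1)^{\alpha_1}-\mu_1^{\alpha_1}\big)+c_2\big((u+\mu_2)^{\alpha_2}-\mu_2^{\alpha_2}\big)\Big)\Big\},\qquad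 u>0,\ t\ge0.$$ Let $E(t)=\inf\{r\ge0: S(r)>t\}$, $t\ge 0$, be its first-exit time, assume that the processes $\{Z(t)\}_{t\ge0}$ and $\{E(t)\}_{t\ge0}$ are independent, and put $Z_2(t)=Z(E(t))$. (i) If $\mathbb{E}|Y|<\infty$, then for every $t\ge0$ the random variables $E(t)$ and $Z_2(t)$ are integrable and $$\mathbb{E}[Z_2(t)]=\frac{k(k+1)}{2}\,\lambda\,\mathbb{E}[Y]\,\mathbb{E}[E(t)].$$ (ii) If $\mathbb{E}[Y^2]<\infty$, then $Z(1)$, $E(t)$ and $Z_2(t)$ are square integrable for every $t\ge 0$, and for all $0\le s\le t$ $$\operatorname{Cov}[Z_2(s),Z_2(t)]=\operatorname{Var}[Z(1)]\,\mathbb{E}[E(s)]+\mathbb{E}[Z(1)]^2\operatorname{Cov}[E(s),E(t)].$$ -/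

import Mathlib

open MeasureTheory ProbabilityTheory Filter Topology
open scoped NNReal

/-- A path on `[0, ∞)` that is right continuous and has left limits. -/
def IsCadlag (x : ℝ≥0 → ℝ) : Prop :=
  ∀ t, ContinuousWithinAt x (Set.Ici t) t ∧ ∃ l, Tendsto x (𝓝[<] t) (𝓝 l)

/-- Real Lévy processes on the time set `[0, ∞)`. -/
structure IsLevyProcess {Ω : Type*} [MeasurableSpace Ω] (L : ℝ≥0 → Ω → ℝ) (P : Measure Ω) :
    Prop where
  measurable : ∀ t, Measurable (L t)
  zero : ∀ᵐ ω ∂P, L 0 ω = 0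
  indepIncrements : HasIndepIncrements L P
  stationaryIncrements : ∀ s h, IdentDistrib (fun ω => L (s + h) ω - L s ω) (L h) P P
  cadlag : ∀ᵐ ω ∂P, IsCadlag (fun t => L t ω)

/-- Lévy subordinators: Lévy processes with almost surely non-decreasing paths. -/
structure IsSubordinator {Ω : Type*} [MeasurableSpace Ω] (S : ℝ≥0 → Ω → ℝ) (P : Measure Ω) :
    Prop extends IsLevyProcess S P where
  monotone : ∀ᵐ ω ∂P, Monotone (fun t => S t ω)

/-- The Laplace exponent `c₁ ((s + μ₁)^α₁ - μ₁^α₁) + c₂ ((s + μ₂)^α₂ - μ₂^α₂)`. -/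
noncomputable def mtssExponent (c₁ c₂ α₁ α₂ μ₁ μ₂ s : ℝ) : ℝ :=
  c₁ * ((s + μ₁) ^ α₁ - μ₁ ^ α₁) + c₂ * ((s + μ₂) ^ α₂ - μ₂ ^ α₂)

/-- Mixtures of tempered stable subordinators, given by their Laplace transform. -/
structure IsMTSS {Ω : Type*} [MeasurableSpace Ω] (c₁ c₂ α₁ α₂ μ₁ μ₂ : ℝ)
    (S : ℝ≥0 → Ω → ℝ) (P : Measure Ω) : Prop extends IsSubordinator S P where
  laplace : ∀ (t : ℝ≥0) (s : ℝ), 0 < s →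
    ∫ ω, Real.exp (-s * S t ω) ∂P = Real.exp (-(t : ℝ) * mtssExponent c₁ c₂ α₁ α₂ μ₁ μ₂ s)

/-- The first exit time (inverse subordinator) `E(t) = inf {r ≥ 0 : S(r) > t}`. The paths of an
MTSS are almost surely unbounded, so the set is almost surely non-empty. -/
noncomputable def firstExit {Ω : Type*} (S : ℝ≥0 → Ω → ℝ) (t : ℝ≥0) (ω : Ω) : ℝ≥0 :=
  sInf {r : ℝ≥0 | (t : ℝ) < S r ω}

/-- The Poisson process with rate `r`: the Lévy process whose value at time `t` has the Poisson
distribution with parameter `r t`. -/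
structure IsPoissonProcess {Ω : Type*} [MeasurableSpace Ω] (r : ℝ≥0) (N : ℝ≥0 → Ω → ℕ)
    (P : Measure Ω) : Prop where
  measurable : ∀ t, Measurable (N t)
  levy : IsLevyProcess (fun t ω => (N t ω : ℝ)) P
  hasLaw : ∀ t, HasLaw (N t) (poissonMeasure (r * t)) P

/-- The process `N^{(k)}(t) = X_1 + ⋯ + X_{N(t)}`; the variable `X_{i+1}` is `X i`. -/
def ppok {Ω : Type*} (N : ℝ≥0 → Ω → ℕ) (X : ℕ → Ω → ℕ) (t : ℝ≥0) (ω : Ω) : ℕ :=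
  ∑ i ∈ Finset.range (N t ω), X i ω

/-- `ppok N X` is a Poisson process of order `k` with parameter `lam`: `N` is a Poisson process
with rate `k * lam`, and `X`, independent of `N`, is an i.i.d. sequence of uniform variables on
`{1, …, k}`. -/
structure IsPPoK {Ω : Type*} [MeasurableSpace Ω] (k : ℕ) (lam : ℝ≥0) (N : ℝ≥0 → Ω → ℕ)
    (X : ℕ → Ω → ℕ) (P : Measure Ω) : Prop where
  poisson : IsPoissonProcess (k * lam) N P
  measurable_step : ∀ i, Measurable (X i)
  indep_step : iIndepFun X P
  hasLaw_step : ∀ i, HasLaw (X i) (uniformOn (Set.Icc 1 k)) P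
  indep : IndepFun (fun ω i => X i ω) (fun ω t => N t ω) P

/-- The process `Z(t) = Y_1 + ⋯ + Y_{N^{(k)}(t)}`; the variable `Y_{i+1}` is `Y i`. -/
def cppok {Ω : Type*} (N : ℝ≥0 → Ω → ℕ) (X : ℕ → Ω → ℕ) (Y : ℕ → Ω → ℝ) (t : ℝ≥0) (ω : Ω) : ℝ :=
  ∑ i ∈ Finset.range (ppok N X t ω), Y i ω

/-- `cppok N X Y` is a compound Poisson process of order `k` with parameters `lam` and `H`:
`ppok N X` is a Poisson process of order `k`, and `Y`, independent of the process `ppok N X`, is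
an i.i.d. sequence with cumulative distribution function `H`. -/
structure IsCPPoK {Ω : Type*} [MeasurableSpace Ω] (k : ℕ) (lam : ℝ≥0) (H : StieltjesFunction ℝ)
    (N : ℝ≥0 → Ω → ℕ) (X : ℕ → Ω → ℕ) (Y : ℕ → Ω → ℝ) (P : Measure Ω) : Prop where
  isPPoK : IsPPoK k lam N X P
  measurable_jump : ∀ i, Measurable (Y i)
  indep_jump : iIndepFun Y P
  cdf_jump : ∀ i, cdf (P.map (Y i)) = H
  indep : IndepFun (fun ω i => Y i ω) (fun ω t => ppok N X t ω) P

/-- The time-changed process `Z_2(t) = Z(E(t))`, with `Z = cppok N X Y` and `E = firstExit S`. -/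
noncomputable def tcppok {Ω : Type*} (N : ℝ≥0 → Ω → ℕ) (X : ℕ → Ω → ℕ) (Y : ℕ → Ω → ℝ)
    (S : ℝ≥0 → Ω → ℝ) (t : ℝ≥0) (ω : Ω) : ℝ :=
  cppok N X Y (firstExit S t ω) ω

/-! Write `m` and `v` for the mean and variance of `Z(1)`. Then `E[Z(t)] = m t` and `E[Z(s) Z(t)] =
v min(s, t) + m² s t`, and these moments are all that is needed of `Z`. By independence and Fubini,
`s` and `t` may be replaced by `E(s) ≤ E(t)`, so that `E[Z_2(s) Z_2(t)] = v E[E(s)] + m² E[E(s)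
E(t)]`; subtracting the product of the means gives the covariance.

The moments, recorded in `HasLinearMoments`, pass from a counting process to its random sums
(`HasLinearMoments.randomSum`). Two applications lead from `N` to `ppok` and on to `cppok`, without
showing that `Z` is a Lévy process.

Two points need care. Fubini requires evaluation of a path at a random time to be jointly
measurable, which fails on the product σ-algebra; `pathEval` is a measurable substitute that agrees
with evaluation on right-continuous paths. And `E(t)` must have a second moment: `E(t) > n` forces
`S(n) ≤ t`, an event of probability at most `exp(t - n φ)`, where `φ > 0` is the Laplace exponent at
`1`. -/

/-! ### Fubini for functions of two independent variables -/

section FubiniIndep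

variable {Ω α β : Type*} [MeasurableSpace Ω] [MeasurableSpace α] [MeasurableSpace β]
  {P : Measure Ω} [IsProbabilityMeasure P]

/-- Tonelli. A bound `G` on the L¹ norms of the sections is enough; for random sums only the
triangle inequality is available. -/
lemma ProbabilityTheory.IndepFun.integrable_comp_of_integral_abs_le {U : Ω → α} {V : Ω → β}
    (h : IndepFun U V P) (hU : AEMeasurable U P) (hV : AEMeasurable V P) {F : α → β → ℝ}
    (hF : Measurable (Function.uncurry F)) {G : β → ℝ}
    (hint : ∀ b, Integrable (fun ω => F (U ω) b) P) (hG : ∀ b, ∫ ω, |F (U ω) b| ∂P ≤ G b)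
    (hGV : Integrable (fun ω => G (V ω)) P) :
    Integrable (fun ω => F (U ω) (V ω)) P := by
  have hmap := (indepFun_iff_map_prod_eq_prod_map_map hU hV).1 h
  have hFb : ∀ b, Measurable (fun a => F a b) := fun b =>
    hF.comp (measurable_id.prodMk measurable_const)
  have := Measure.isProbabilityMeasure_map hU
  have := Measure.isProbabilityMeasure_map hV
  have key : Integrable (Function.uncurry F) ((P.map U).prod (P.map V)) := by
    rw [integrable_prod_iff' hF.aestronglyMeasurable]
    constructor
    · refine Eventually.of_forall fun b => ?_
      exact (integrable_map_measure (hFb b).aestronglyMeasurable hU).2 (hint b)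
    · have hsm : StronglyMeasurable fun b => ∫ a, ‖Function.uncurry F (a, b)‖ ∂(P.map U) :=
        hF.norm.stronglyMeasurable.integral_prod_left'
      refine (integrable_map_measure hsm.aestronglyMeasurable hV).2 ?_
      refine hGV.mono' (hsm.measurable.comp_aemeasurable hV).aestronglyMeasurable
        (Eventually.of_forall fun ω => ?_)
      simp only [Function.comp_apply, Function.uncurry_apply_pair]
      rw [integral_map hU (hFb _).norm.aestronglyMeasurable, Real.norm_of_nonneg (by positivity)]
      exact hG _
  rw [← hmap] at key
  exact (integrable_map_measure hF.aestronglyMeasurable (hU.prodMk hV)).1 key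

lemma ProbabilityTheory.IndepFun.integral_comp_eq {U : Ω → α} {V : Ω → β}
    (h : IndepFun U V P) (hU : AEMeasurable U P) (hV : AEMeasurable V P) {F : α → β → ℝ}
    (hF : Measurable (Function.uncurry F)) {g : β → ℝ}
    (hg : ∀ b, ∫ ω, F (U ω) b ∂P = g b)
    (hint : Integrable (fun ω => F (U ω) (V ω)) P) :
    ∫ ω, F (U ω) (V ω) ∂P = ∫ ω, g (V ω) ∂P := by
  have hmap := (indepFun_iff_map_prod_eq_prod_map_map hU hV).1 h
  have hFb : ∀ b, Measurable (fun a => F a b) := fun b =>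
    hF.comp (measurable_id.prodMk measurable_const)
  have := Measure.isProbabilityMeasure_map hU
  have := Measure.isProbabilityMeasure_map hV
  have key : Integrable (Function.uncurry F) ((P.map U).prod (P.map V)) := by
    rw [← hmap]
    exact (integrable_map_measure hF.aestronglyMeasurable (hU.prodMk hV)).2 hint
  have hsm : StronglyMeasurable fun b => ∫ a, Function.uncurry F (a, b) ∂(P.map U) :=
    hF.stronglyMeasurable.integral_prod_left'
  calc ∫ ω, F (U ω) (V ω) ∂P
      = ∫ p, Function.uncurry F p ∂(P.map fun ω => (U ω, V ω)) :=
        (integral_map (hU.prodMk hV) hF.aestronglyMeasurable).symm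
    _ = ∫ b, ∫ a, Function.uncurry F (a, b) ∂(P.map U) ∂(P.map V) := by
        rw [hmap, integral_prod_symm _ key]
    _ = ∫ ω, g (V ω) ∂P := by
        rw [integral_map hV hsm.aestronglyMeasurable]
        refine integral_congr_ae (Eventually.of_forall fun ω => ?_)
        simp only [Function.uncurry_apply_pair]
        rw [integral_map hU (hFb _).aestronglyMeasurable, hg]

end FubiniIndep

/-! ### Moments of the Poisson distribution -/

section PoissonMoments

open scoped Nat

lemma hasSum_poisson_mul_id (r : ℝ≥0) :
    HasSum (fun n : ℕ => Real.exp (-r) * (r : ℝ) ^ n / n ! * n) r := by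
  -- The term at `0` vanishes and `n / n! = 1 / (n - 1)!`, so the shifted series is `r` times the
  -- total mass.
  rw [← hasSum_nat_add_iff' 1]
  have h := (hasSum_one_poissonMeasure r).mul_left (r : ℝ)
  simp only [mul_one] at h
  simp only [Finset.range_one, Finset.sum_singleton, Nat.cast_zero, mul_zero, sub_zero]
  refine h.congr_fun fun n => ?_
  rw [Nat.factorial_succ]
  push_cast
  rw [pow_succ]
  field_simp

lemma hasSum_poisson_mul_sq (r : ℝ≥0) :
    HasSum (fun n : ℕ => Real.exp (-r) * (r : ℝ) ^ n / n ! * (n : ℝ) ^ 2) (r + r ^ 2) := by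
  -- The same shift leaves a factor `n + 1`: `r` times the sum of first moment and total mass.
  rw [← hasSum_nat_add_iff' 1]
  have h := ((hasSum_poisson_mul_id r).add (hasSum_one_poissonMeasure r)).mul_left (r : ℝ)
  have e : (r : ℝ) * (r + 1) = r + r ^ 2 := by ring
  rw [e] at h
  simp only [Finset.range_one, Finset.sum_singleton, Nat.cast_zero, ne_eq, OfNat.ofNat_ne_zero,
    not_false_eq_true, zero_pow, mul_zero, sub_zero]
  refine h.congr_fun fun n => ?_
  rw [Nat.factorial_succ]
  push_cast
  rw [pow_succ]
  field_simp

lemma integral_natCast_poissonMeasure (r : ℝ≥0) :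
    ∫ n : ℕ, (n : ℝ) ∂(poissonMeasure r) = r := by
  rw [integral_poissonMeasure]
  exact (hasSum_poisson_mul_id r).tsum_eq

lemma integral_natCast_sq_poissonMeasure (r : ℝ≥0) :
    ∫ n : ℕ, (n : ℝ) ^ 2 ∂(poissonMeasure r) = r + r ^ 2 := by
  rw [integral_poissonMeasure]
  exact (hasSum_poisson_mul_sq r).tsum_eq

lemma memLp_natCast_poissonMeasure (r : ℝ≥0) :
    MemLp (fun n : ℕ => (n : ℝ)) 2 (poissonMeasure r) := by
  rw [memLp_two_iff_integrable_sq (by fun_prop), integrable_poissonMeasure_iff]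
  refine (hasSum_poisson_mul_sq r).summable.congr fun n => ?_
  rw [Real.norm_of_nonneg (by positivity)]

end PoissonMoments

/-! ### Moments of random sums -/

section RandomSum

variable {Ω : Type*} [MeasurableSpace Ω] {P : Measure Ω} [IsProbabilityMeasure P]
  {Y : ℕ → Ω → ℝ} {A B : Ω → ℕ}

lemma measurable_sum_range_uncurry :
    Measurable (Function.uncurry fun (y : ℕ → ℝ) (n : ℕ) => ∑ i ∈ Finset.range n, y i) :=
  measurable_from_prod_countable_left fun n => by
    simp only [Function.uncurry_apply_pair]; fun_prop

lemma measurable_randomSum (hY : ∀ i, Measurable (Y i)) (hA : Measurable A) :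
    Measurable fun ω => ∑ i ∈ Finset.range (A ω), Y i ω :=
  measurable_sum_range_uncurry.comp ((measurable_pi_iff.2 hY).prodMk hA)

lemma integrable_randomSum (hY : ∀ i, Measurable (Y i)) (hA : Measurable A)
    (hint : ∀ i, Integrable (Y i) P) (hid : ∀ i, IdentDistrib (Y i) (Y 0) P P)
    (h : IndepFun (fun ω i => Y i ω) A P) (hAi : Integrable (fun ω => (A ω : ℝ)) P) :
    Integrable (fun ω => ∑ i ∈ Finset.range (A ω), Y i ω) P := by
  refine h.integrable_comp_of_integral_abs_le (measurable_pi_iff.2 hY).aemeasurable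
    hA.aemeasurable (F := fun y n => ∑ i ∈ Finset.range n, y i)
    (G := fun n => (n : ℝ) * ∫ ω, |Y 0 ω| ∂P) measurable_sum_range_uncurry
    (fun n => integrable_finsetSum _ fun i _ => hint i) (fun n => ?_) (hAi.mul_const _)
  calc ∫ ω, |∑ i ∈ Finset.range n, Y i ω| ∂P
      ≤ ∫ ω, ∑ i ∈ Finset.range n, |Y i ω| ∂P :=
        integral_mono (integrable_finsetSum _ fun i _ => hint i).abs
          (integrable_finsetSum _ fun i _ => (hint i).abs)
          fun ω => Finset.abs_sum_le_sum_abs _ _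
    _ = n * ∫ ω, |Y 0 ω| ∂P := by
        have habs : ∀ i, ∫ ω, |Y i ω| ∂P = ∫ ω, |Y 0 ω| ∂P :=
          fun i => ((hid i).comp measurable_norm).integral_eq
        rw [integral_finsetSum _ fun i _ => (hint i).abs]
        simp [habs]

lemma integral_randomSum (hY : ∀ i, Measurable (Y i)) (hA : Measurable A)
    (hint : ∀ i, Integrable (Y i) P) (hid : ∀ i, IdentDistrib (Y i) (Y 0) P P)
    (h : IndepFun (fun ω i => Y i ω) A P) (hAi : Integrable (fun ω => (A ω : ℝ)) P) :
    ∫ ω, ∑ i ∈ Finset.range (A ω), Y i ω ∂P = (∫ ω, (A ω : ℝ) ∂P) * ∫ ω, Y 0 ω ∂P := by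
  rw [h.integral_comp_eq (measurable_pi_iff.2 hY).aemeasurable
    hA.aemeasurable (F := fun y n => ∑ i ∈ Finset.range n, y i)
    (g := fun n => (n : ℝ) * ∫ ω, Y 0 ω ∂P) measurable_sum_range_uncurry (fun n => ?_)
    (integrable_randomSum hY hA hint hid h hAi), integral_mul_const]
  rw [integral_finsetSum _ fun i _ => hint i,
    Finset.sum_congr rfl fun i _ => (hid i).integral_eq]
  simp

/-- `E[Y_i Y_j]` is the squared mean, plus the variance when `i = j`. As `a ≤ b`, exactly `a` of the
`a b` pairs are diagonal. -/
lemma integral_sum_range_mul_sum_range (hL : ∀ i, MemLp (Y i) 2 P)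
    (hid : ∀ i, IdentDistrib (Y i) (Y 0) P P) (hind : iIndepFun Y P) {a b : ℕ} (hab : a ≤ b) :
    ∫ ω, (∑ i ∈ Finset.range a, Y i ω) * (∑ j ∈ Finset.range b, Y j ω) ∂P =
      a * Var[Y 0; P] + a * b * (∫ ω, Y 0 ω ∂P) ^ 2 := by
  have hii : ∀ i j, ∫ ω, Y i ω * Y j ω ∂P =
      (if i = j then Var[Y 0; P] else 0) + (∫ ω, Y 0 ω ∂P) ^ 2 := by
    intro i j
    have hc := covariance_eq_sub (hL i) (hL j)
    simp only [Pi.mul_apply] at hc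
    rw [(hid i).integral_eq, (hid j).integral_eq] at hc
    have : cov[Y i, Y j; P] = if i = j then Var[Y 0; P] else 0 := by
      split_ifs with hij
      · rw [hij, covariance_self (hL j).aemeasurable, (hid j).variance_eq]
      · exact (hind.indepFun hij).covariance_eq_zero (hL i) (hL j)
    linarith
  simp_rw [Finset.sum_mul_sum]
  have hI : ∀ i j, Integrable (fun ω => Y i ω * Y j ω) P := fun i j => (hL i).integrable_mul (hL j)
  rw [integral_finsetSum _ fun i _ => integrable_finsetSum _ fun j _ => hI i j]
  simp_rw [integral_finsetSum _ fun j _ => hI _ j, hii, Finset.sum_add_distrib]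
  congr 1
  · simp_rw [Finset.sum_ite_eq]
    rw [Finset.sum_congr rfl fun i hi => if_pos (Finset.range_subset_range.2 hab hi)]
    simp
  · simp [mul_assoc]

lemma memLp_randomSum (hY : ∀ i, Measurable (Y i)) (hA : Measurable A)
    (hL : ∀ i, MemLp (Y i) 2 P) (hid : ∀ i, IdentDistrib (Y i) (Y 0) P P) (hind : iIndepFun Y P)
    (h : IndepFun (fun ω i => Y i ω) A P) (hAi : MemLp (fun ω => (A ω : ℝ)) 2 P) :
    MemLp (fun ω => ∑ i ∈ Finset.range (A ω), Y i ω) 2 P := by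
  rw [memLp_two_iff_integrable_sq (measurable_randomSum hY hA).aestronglyMeasurable]
  refine h.integrable_comp_of_integral_abs_le (measurable_pi_iff.2 hY).aemeasurable
    hA.aemeasurable (F := fun y n => (∑ i ∈ Finset.range n, y i) ^ 2)
    (G := fun n => n * Var[Y 0; P] + n * n * (∫ ω, Y 0 ω ∂P) ^ 2)
    (measurable_sum_range_uncurry.pow_const 2)
    (fun n => (memLp_finsetSum _ fun i _ => hL i).integrable_sq) (fun n => ?_)
    (((hAi.integrable one_le_two).mul_const _).add ((hAi.integrable_mul hAi).mul_const _))
  rw [← integral_sum_range_mul_sum_range hL hid hind le_rfl]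
  simp [sq]

lemma integral_randomSum_mul_randomSum (hY : ∀ i, Measurable (Y i)) (hA : Measurable A)
    (hB : Measurable B) (hAB : ∀ᵐ ω ∂P, A ω ≤ B ω)
    (hL : ∀ i, MemLp (Y i) 2 P) (hid : ∀ i, IdentDistrib (Y i) (Y 0) P P) (hind : iIndepFun Y P)
    (h : IndepFun (fun ω i => Y i ω) (fun ω => (A ω, B ω)) P)
    (hAi : MemLp (fun ω => (A ω : ℝ)) 2 P) (hBi : MemLp (fun ω => (B ω : ℝ)) 2 P) :
    ∫ ω, (∑ i ∈ Finset.range (A ω), Y i ω) * (∑ i ∈ Finset.range (B ω), Y i ω) ∂P =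
      (∫ ω, (A ω : ℝ) ∂P) * Var[Y 0; P] +
        (∫ ω, (A ω : ℝ) * B ω ∂P) * (∫ ω, Y 0 ω ∂P) ^ 2 := by
  have hS : ∀ C : Ω → ℕ, Measurable C → IndepFun (fun ω i => Y i ω) C P →
      MemLp (fun ω => (C ω : ℝ)) 2 P → MemLp (fun ω => ∑ i ∈ Finset.range (C ω), Y i ω) 2 P :=
    fun C hC hi hL' => memLp_randomSum hY hC hL hid hind hi hL'
  have hSA := hS A hA (h.comp measurable_id measurable_fst) hAi
  have hSB := hS B hB (h.comp measurable_id measurable_snd) hBi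
  have hm : Measurable (Function.uncurry fun (y : ℕ → ℝ) (p : ℕ × ℕ) =>
      (∑ i ∈ Finset.range p.1, y i) * (∑ i ∈ Finset.range p.2, y i)) :=
    (measurable_sum_range_uncurry.comp (measurable_fst.prodMk (measurable_fst.comp measurable_snd))).mul
    (measurable_sum_range_uncurry.comp (measurable_fst.prodMk (measurable_snd.comp measurable_snd)))
  rw [h.integral_comp_eq (measurable_pi_iff.2 hY).aemeasurable (hA.prodMk hB).aemeasurable
    (F := fun y p => (∑ i ∈ Finset.range p.1, y i) * (∑ i ∈ Finset.range p.2, y i))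
    (g := fun p => ∫ ω, (∑ i ∈ Finset.range p.1, Y i ω) * (∑ j ∈ Finset.range p.2, Y j ω) ∂P)
    hm (fun p => rfl) (hSA.integrable_mul hSB)]
  rw [← integral_mul_const, ← integral_mul_const, ← integral_add]
  · refine integral_congr_ae (hAB.mono fun ω hω => ?_)
    exact integral_sum_range_mul_sum_range hL hid hind hω
  · exact (hAi.integrable one_le_two).mul_const _
  · exact (hAi.integrable_mul hBi).mul_const _

end RandomSum

/-! ### First and second moments of the compound processes -/

section CompoundProcesses

variable {Ω : Type*} [MeasurableSpace Ω] {P : Measure Ω}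

/-- `W` has the first and second order moments of a Lévy process whose value at time `1` has mean
`m` and variance `v`. -/
structure HasLinearMoments (W : ℝ≥0 → Ω → ℝ) (m v : ℝ) (P : Measure Ω) : Prop where
  memLp : ∀ t, MemLp (W t) 2 P
  mean : ∀ t, ∫ ω, W t ω ∂P = m * t
  mul : ∀ s t, s ≤ t → ∫ ω, W s ω * W t ω ∂P = v * s + m ^ 2 * s * t

lemma HasLinearMoments.variance_one [IsProbabilityMeasure P] {W : ℝ≥0 → Ω → ℝ} {m v : ℝ}
    (h : HasLinearMoments W m v P) : Var[W 1; P] = v := by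
  rw [variance_eq_sub (h.memLp 1), h.mean]
  have := h.mul 1 1 le_rfl
  simp only [Pi.pow_apply, sq] at *
  rw [this]
  simp

lemma HasLinearMoments.mul_min {W : ℝ≥0 → Ω → ℝ} {m v : ℝ} (h : HasLinearMoments W m v P)
    (s t : ℝ≥0) :
    ∫ ω, W s ω * W t ω ∂P = v * (min s t : ℝ≥0) + m ^ 2 * s * t := by
  rcases le_total s t with hst | hst
  · rw [h.mul s t hst, min_eq_left hst]
  · simp_rw [mul_comm (W s _)]
    rw [h.mul t s hst, min_eq_right hst]
    ring

/-- A compound process whose counting process and whose jumps have second moments. -/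
lemma HasLinearMoments.randomSum [IsProbabilityMeasure P] {A : ℝ≥0 → Ω → ℕ} {m v : ℝ}
    (h : HasLinearMoments (fun t ω => (A t ω : ℝ)) m v P) (hA : ∀ t, Measurable (A t))
    (hmono : ∀ s t, s ≤ t → ∀ᵐ ω ∂P, A s ω ≤ A t ω) {Y : ℕ → Ω → ℝ}
    (hY : ∀ i, Measurable (Y i)) (hL : MemLp (Y 0) 2 P)
    (hid : ∀ i, IdentDistrib (Y i) (Y 0) P P) (hind : iIndepFun Y P)
    (hYA : IndepFun (fun ω i => Y i ω) (fun ω t => A t ω) P) :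
    HasLinearMoments (fun t ω => ∑ i ∈ Finset.range (A t ω), Y i ω) (m * ∫ ω, Y 0 ω ∂P)
      (m * Var[Y 0; P] + v * (∫ ω, Y 0 ω ∂P) ^ 2) P := by
  have hLi : ∀ i, MemLp (Y i) 2 P := fun i => (hid i).memLp_iff.2 hL
  have hAt : ∀ t, IndepFun (fun ω i => Y i ω) (A t) P := fun t =>
    hYA.comp measurable_id (measurable_pi_apply t)
  refine ⟨fun t => memLp_randomSum hY (hA t) hLi hid hind (hAt t) (h.memLp t), fun t => ?_,
    fun s t hst => ?_⟩
  · rw [integral_randomSum hY (hA t) (fun i => (hLi i).integrable one_le_two) hid (hAt t)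
      ((h.memLp t).integrable one_le_two), h.mean]
    ring
  -- Inserting `E[A_s A_t] = v s + m² s t`, the coefficient of `s` is the new variance (law of total
  -- variance) and that of `s t` the squared new mean.
  · rw [integral_randomSum_mul_randomSum hY (hA s) (hA t) (hmono s t hst) hLi hid hind
      (hYA.comp measurable_id ((measurable_pi_apply s).prodMk (measurable_pi_apply t)))
      (h.memLp s) (h.memLp t), h.mean, h.mul s t hst]
    ring

/-- The increment over `[s, s + u]` has the law of `N u`, which is non-negative. -/
lemma IsPoissonProcess.ae_mono {r : ℝ≥0} {N : ℝ≥0 → Ω → ℕ} (h : IsPoissonProcess r N P)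
    {s t : ℝ≥0} (hst : s ≤ t) : ∀ᵐ ω ∂P, N s ω ≤ N t ω := by
  obtain ⟨u, rfl⟩ := exists_add_of_le hst
  have h1 : ∀ᵐ ω ∂P, (N (s + u) ω : ℝ) - N s ω ∈ Set.Ici (0 : ℝ) :=
    (h.levy.stationaryIncrements s u).symm.ae_mem_snd measurableSet_Ici
      (Eventually.of_forall fun ω => Set.mem_Ici.2 (Nat.cast_nonneg (N u ω)))
  filter_upwards [h1] with ω hω
  simpa using hω

/-- Split `N_s N_t = N_s² + N_s (N_t - N_s)`; the factors of the last product are independent. -/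
lemma IsPoissonProcess.hasLinearMoments [IsProbabilityMeasure P] {r : ℝ≥0} {N : ℝ≥0 → Ω → ℕ}
    (h : IsPoissonProcess r N P) : HasLinearMoments (fun t ω => (N t ω : ℝ)) r r P := by
  have hL : ∀ t, MemLp (fun ω => (N t ω : ℝ)) 2 P := fun t => by
    have := memLp_natCast_poissonMeasure (r * t)
    rw [← (h.hasLaw t).map_eq] at this
    exact (memLp_map_measure_iff (by fun_prop) (h.hasLaw t).aemeasurable).1 this
  have hmean : ∀ t, ∫ ω, (N t ω : ℝ) ∂P = r * t := fun t => by
    have := (h.hasLaw t).integral_comp (f := fun n : ℕ => (n : ℝ)) (by fun_prop)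
    rw [integral_natCast_poissonMeasure] at this
    simpa using this
  have hsq : ∀ t, ∫ ω, (N t ω : ℝ) ^ 2 ∂P = r * t + (r * t) ^ 2 := fun t => by
    have := (h.hasLaw t).integral_comp (f := fun n : ℕ => (n : ℝ) ^ 2) (by fun_prop)
    rw [integral_natCast_sq_poissonMeasure] at this
    simpa using this
  refine ⟨hL, hmean, fun s t hst => ?_⟩
  have hind := h.levy.indepIncrements.indepFun_eval_sub (zero_le (a := s)) hst h.levy.zero
  have hLs : MemLp (fun ω => (N t ω : ℝ) - N s ω) 2 P := (hL t).sub (hL s)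
  have hcov : ∫ ω, (N s ω : ℝ) * ((N t ω : ℝ) - N s ω) ∂P = (r * s) * (r * t - r * s) := by
    have := hind.integral_fun_mul_eq_mul_integral (hL s).aestronglyMeasurable
      hLs.aestronglyMeasurable
    simp only [Pi.sub_apply] at this
    rw [this, integral_sub ((hL t).integrable one_le_two) ((hL s).integrable one_le_two),
      hmean, hmean]
  calc ∫ ω, (N s ω : ℝ) * N t ω ∂P
      = ∫ ω, ((N s ω : ℝ) ^ 2 + (N s ω : ℝ) * ((N t ω : ℝ) - N s ω)) ∂P := by
        congr 1; ext ω; ring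
    _ = _ := by
        have hI : Integrable (fun ω => (N s ω : ℝ) * ((N t ω : ℝ) - N s ω)) P :=
          (hL s).integrable_mul hLs
        rw [integral_add (hL s).integrable_sq hI, hsq, hcov]
        ring

lemma integral_natCast_uniformOn_Icc {k : ℕ} (hk : 1 ≤ k) :
    ∫ n : ℕ, (n : ℝ) ∂(uniformOn (Set.Icc 1 k)) = (k + 1) / 2 := by
  have hsum : ∑ n ∈ Finset.Icc 1 k, (n : ℝ) = k * (k + 1) / 2 := by
    clear hk
    induction k with
    | zero => simp
    | succ k ih => rw [Finset.sum_Icc_succ_top (by omega), ih]; push_cast; ring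
  have hc : Measure.count (Set.Icc 1 k) = k := by
    rw [← Finset.coe_Icc, Measure.count_apply_finset]; simp
  -- Counting measure on `ℕ` is infinite; its restriction to `{1, …, k}` is finite, which gives
  -- integrability there.
  have hfin : IsFiniteMeasure (Measure.count.restrict (Finset.Icc 1 k : Set ℕ)) :=
    ⟨by rw [Measure.restrict_apply_univ, Finset.coe_Icc, hc]; exact ENNReal.natCast_lt_top k⟩
  have hi : IntegrableOn (fun n : ℕ => (n : ℝ)) (Finset.Icc 1 k : Set ℕ) Measure.count := by
    have := IntegrableOn.finset (μ := Measure.count.restrict (Finset.Icc 1 k : Set ℕ))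
      (s := Finset.Icc 1 k) (f := fun n : ℕ => (n : ℝ))
    rwa [IntegrableOn, Measure.restrict_restrict_of_subset subset_rfl] at this
  rw [uniformOn, ProbabilityTheory.cond, integral_smul_measure, hc, ← Finset.coe_Icc,
    setIntegral_finset _ hi]
  have : (k : ℝ) ≠ 0 := by positivity
  simp [measureReal_def, hsum]
  field_simp

lemma HasLaw.ae_le_of_uniformOn_Icc {X : Ω → ℕ} {k : ℕ}
    (h : HasLaw X (uniformOn (Set.Icc 1 k)) P) : ∀ᵐ ω ∂P, X ω ≤ k := by
  rw [h.ae_iff (p := fun n => n ≤ k) (by fun_prop)]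
  have : ∀ᵐ n ∂(uniformOn (Set.Icc 1 k)), n ∈ Set.Icc 1 k :=
    ae_cond_mem (Set.finite_Icc 1 k).measurableSet
  filter_upwards [this] with n hn using hn.2

lemma measurable_ppok {N : ℝ≥0 → Ω → ℕ} {X : ℕ → Ω → ℕ} (hX : ∀ i, Measurable (X i)) {t : ℝ≥0}
    (hN : Measurable (N t)) : Measurable (ppok N X t) := by
  have : Measurable (Function.uncurry fun (y : ℕ → ℕ) (n : ℕ) => ∑ i ∈ Finset.range n, y i) :=
    measurable_from_prod_countable_left fun n => by
      simp only [Function.uncurry_apply_pair]; fun_prop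
  exact this.comp ((measurable_pi_iff.2 hX).prodMk hN)

lemma cast_ppok {Ω : Type*} (N : ℝ≥0 → Ω → ℕ) (X : ℕ → Ω → ℕ) (t : ℝ≥0) (ω : Ω) :
    (ppok N X t ω : ℝ) = ∑ i ∈ Finset.range (N t ω), (X i ω : ℝ) := by
  simp [ppok]

variable {k : ℕ} {lam : ℝ≥0} {H : StieltjesFunction ℝ}
  {N : ℝ≥0 → Ω → ℕ} {X : ℕ → Ω → ℕ} {Y : ℕ → Ω → ℝ}

lemma IsPPoK.ae_mono (h : IsPPoK k lam N X P) {s t : ℝ≥0} (hst : s ≤ t) :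
    ∀ᵐ ω ∂P, ppok N X s ω ≤ ppok N X t ω := by
  filter_upwards [h.poisson.ae_mono hst] with ω hω
  exact Finset.sum_le_sum_of_subset (Finset.range_subset_range.2 hω)

lemma IsCPPoK.measurable_ppok (h : IsCPPoK k lam H N X Y P) (t : ℝ≥0) :
    Measurable (ppok N X t) :=
  _root_.measurable_ppok h.isPPoK.measurable_step (h.isPPoK.poisson.measurable t)

lemma IsCPPoK.measurable (h : IsCPPoK k lam H N X Y P) (t : ℝ≥0) : Measurable (cppok N X Y t) :=
  measurable_randomSum h.measurable_jump (h.measurable_ppok t)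

variable [IsProbabilityMeasure P]

/-- The mean is rate `k λ` times step mean `(k + 1) / 2`. The value of `v` is immaterial:
`HasLinearMoments.variance_one` recovers it as the variance at time `1`. -/
lemma IsPPoK.hasLinearMoments (h : IsPPoK k lam N X P) (hk : 1 ≤ k) :
    ∃ v, HasLinearMoments (fun t ω => (ppok N X t ω : ℝ)) (k * (k + 1) / 2 * lam) v P := by
  have hlaw : ∀ i, IdentDistrib (X i) (X 0) P P := fun i =>
    ⟨(h.measurable_step i).aemeasurable, (h.measurable_step 0).aemeasurable,
      (h.hasLaw_step i).map_eq.trans (h.hasLaw_step 0).map_eq.symm⟩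
  have hcast : Measurable fun n : ℕ => (n : ℝ) := .of_discrete
  have hmeas : ∀ i, Measurable fun ω => (X i ω : ℝ) := fun i => hcast.comp (h.measurable_step i)
  have hL : MemLp (fun ω => (X 0 ω : ℝ)) 2 P := by
    refine MemLp.of_bound (hmeas 0).aestronglyMeasurable k ?_
    filter_upwards [HasLaw.ae_le_of_uniformOn_Icc (h.hasLaw_step 0)] with ω hω
    simpa using hω
  have hmean : ∫ ω, (X 0 ω : ℝ) ∂P = (k + 1) / 2 := by
    rw [← integral_natCast_uniformOn_Icc hk]
    exact (h.hasLaw_step 0).integral_comp (f := fun n : ℕ => (n : ℝ)) (by fun_prop)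
  have hind : iIndepFun (fun i ω => (X i ω : ℝ)) P :=
    h.indep_step.comp (fun _ n => (n : ℝ)) fun _ => hcast
  have hi : IndepFun (fun ω i => (X i ω : ℝ)) (fun ω t => N t ω) P :=
    h.indep.comp (φ := fun x i => ((x i : ℕ) : ℝ)) (by fun_prop) measurable_id
  have key := h.poisson.hasLinearMoments.randomSum h.poisson.measurable
    (fun s t hst => h.poisson.ae_mono hst) hmeas hL (fun i => (hlaw i).comp hcast) hind hi
  simp_rw [← cast_ppok] at key
  rw [hmean] at key
  have hm : ((k * lam : ℝ≥0) : ℝ) * ((k + 1) / 2) = k * (k + 1) / 2 * lam := by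
    push_cast
    ring
  rw [hm] at key
  exact ⟨_, key⟩

lemma IsCPPoK.identDistrib (h : IsCPPoK k lam H N X Y P) (i : ℕ) :
    IdentDistrib (Y i) (Y 0) P P := by
  refine ⟨(h.measurable_jump i).aemeasurable, (h.measurable_jump 0).aemeasurable, ?_⟩
  have h1 := Measure.isProbabilityMeasure_map (h.measurable_jump i).aemeasurable (μ := P)
  have h0 := Measure.isProbabilityMeasure_map (h.measurable_jump 0).aemeasurable (μ := P)
  exact Measure.eq_of_cdf _ _ ((h.cdf_jump i).trans (h.cdf_jump 0).symm)

lemma IsCPPoK.hasLinearMoments (h : IsCPPoK k lam H N X Y P) (hk : 1 ≤ k)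
    (hL : MemLp (Y 0) 2 P) :
    ∃ v, HasLinearMoments (cppok N X Y) (k * (k + 1) / 2 * lam * ∫ ω, Y 0 ω ∂P) v P := by
  obtain ⟨v, hv⟩ := h.isPPoK.hasLinearMoments hk
  exact ⟨_, hv.randomSum h.measurable_ppok (fun s t hst => h.isPPoK.ae_mono hst)
    h.measurable_jump hL h.identDistrib h.indep_jump h.indep⟩

lemma IsCPPoK.integrable (h : IsCPPoK k lam H N X Y P) (hk : 1 ≤ k) (hY : Integrable (Y 0) P)
    (t : ℝ≥0) : Integrable (cppok N X Y t) P := by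
  obtain ⟨v, hv⟩ := h.isPPoK.hasLinearMoments hk
  exact integrable_randomSum h.measurable_jump (h.measurable_ppok t)
    (fun i => (h.identDistrib i).integrable_iff.2 hY) h.identDistrib
    (h.indep.comp measurable_id (measurable_pi_apply t)) ((hv.memLp t).integrable one_le_two)

lemma IsCPPoK.integral_eq (h : IsCPPoK k lam H N X Y P) (hk : 1 ≤ k) (hY : Integrable (Y 0) P)
    (t : ℝ≥0) :
    ∫ ω, cppok N X Y t ω ∂P = k * (k + 1) / 2 * lam * (∫ ω, Y 0 ω ∂P) * t := by
  obtain ⟨v, hv⟩ := h.isPPoK.hasLinearMoments hk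
  have := integral_randomSum h.measurable_jump (h.measurable_ppok t)
    (fun i => (h.identDistrib i).integrable_iff.2 hY) h.identDistrib
    (h.indep.comp measurable_id (measurable_pi_apply t)) ((hv.memLp t).integrable one_le_two)
  rw [hv.mean] at this
  exact this.trans (by ring)

/-- `|Z(t)|` is at most the random sum of the `|Y_i|`. A bound linear in `t` lets the time change
need only a first moment of `E(t)`. -/
lemma IsCPPoK.integral_abs_le (h : IsCPPoK k lam H N X Y P) (hk : 1 ≤ k)
    (hY : Integrable (Y 0) P) (t : ℝ≥0) :
    ∫ ω, |cppok N X Y t ω| ∂P ≤ k * (k + 1) / 2 * lam * (∫ ω, |Y 0 ω| ∂P) * t := by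
  obtain ⟨v, hv⟩ := h.isPPoK.hasLinearMoments hk
  have hYi : ∀ i, Integrable (Y i) P := fun i => (h.identDistrib i).integrable_iff.2 hY
  have hm : ∀ i, Measurable fun ω => |Y i ω| := fun i => (h.measurable_jump i).norm
  have hid : ∀ i, IdentDistrib (fun ω => |Y i ω|) (fun ω => |Y 0 ω|) P P := fun i =>
    (h.identDistrib i).comp measurable_norm
  have hind : IndepFun (fun ω i => |Y i ω|) (ppok N X t) P :=
    h.indep.comp (φ := fun y i => |y i|)
      (measurable_pi_iff.2 fun i => (measurable_pi_apply i).norm) (measurable_pi_apply t)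
  have hA := (hv.memLp t).integrable one_le_two
  have h1 := integral_randomSum hm (h.measurable_ppok t) (fun i => (hYi i).abs) hid hind hA
  have h2 := integrable_randomSum hm (h.measurable_ppok t) (fun i => (hYi i).abs) hid hind hA
  rw [hv.mean] at h1
  calc ∫ ω, |cppok N X Y t ω| ∂P
      ≤ ∫ ω, ∑ i ∈ Finset.range (ppok N X t ω), |Y i ω| ∂P :=
        integral_mono (h.integrable hk hY t).abs h2 fun ω => Finset.abs_sum_le_sum_abs _ _
    _ = _ := by rw [h1]; ring

end CompoundProcesses

/-! ### Measurable evaluation of right-continuous paths -/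

section PathEvaluation

/-- The value at `e` of a right-continuous path, computed from countably many of its values. -/
noncomputable def pathEval (z : ℝ≥0 → ℝ) (e : ℝ≥0) : ℝ :=
  limUnder atTop fun n : ℕ => z (⌈e * (n + 1)⌉₊ / (n + 1))

/-- The `n`-th approximant reads `z` only on the countable grid `j / (n + 1)`, so it is jointly
measurable, and hence so is `limUnder`. -/
lemma measurable_pathEval : Measurable (Function.uncurry pathEval) := by
  have h : ∀ n : ℕ, StronglyMeasurable fun p : (ℝ≥0 → ℝ) × ℝ≥0 =>
      p.1 (⌈p.2 * (n + 1)⌉₊ / (n + 1)) := fun n => by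
    have h1 : Measurable (Function.uncurry fun (z : ℝ≥0 → ℝ) (j : ℕ) =>
        z ((j : ℝ≥0) / (n + 1))) :=
      measurable_from_prod_countable_left fun j => by
        simp only [Function.uncurry_apply_pair]
        exact measurable_pi_apply _
    exact (h1.comp (measurable_fst.prodMk
      (Nat.measurable_ceil.comp (measurable_snd.mul_const _)))).stronglyMeasurable
  exact (StronglyMeasurable.limUnder h).measurable

lemma aemeasurable_pathEval {Ω : Type*} [MeasurableSpace Ω] {P : Measure Ω}
    {Z : Ω → ℝ≥0 → ℝ} {T : Ω → ℝ≥0} (hZ : AEMeasurable Z P) (hT : AEMeasurable T P) :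
    AEMeasurable (fun ω => pathEval (Z ω) (T ω)) P := by
  have h := measurable_pathEval.comp_aemeasurable (hZ.prodMk hT)
  exact h

/-- The grid points tend to `e` and are never below it, so right continuity suffices. -/
lemma pathEval_eq {z : ℝ≥0 → ℝ} {e : ℝ≥0} (h : ContinuousWithinAt z (Set.Ici e) e) :
    pathEval z e = z e := by
  refine Tendsto.limUnder_eq (h.tendsto.comp (tendsto_nhdsWithin_iff.2 ⟨?_, ?_⟩))
  · rw [← NNReal.tendsto_coe]
    have h1 := tendsto_nat_ceil_mul_div_atTop (R := ℝ) e.2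
    have h2 : Tendsto (fun n : ℕ => (n : ℝ) + 1) atTop atTop :=
      tendsto_atTop_add_const_right _ _ tendsto_natCast_atTop_atTop
    refine (h1.comp h2).congr fun n => ?_
    have : ⌈(e : ℝ) * ((n : ℝ) + 1)⌉₊ = ⌈e * ((n : ℝ≥0) + 1)⌉₊ :=
      eq_of_forall_ge_iff fun c => by
        rw [Nat.ceil_le, Nat.ceil_le, ← NNReal.coe_le_coe]; push_cast; rfl
    simp only [Function.comp_apply]
    push_cast
    congr 2
  · refine Eventually.of_forall fun n => ?_
    rw [Set.mem_Ici, le_div_iff₀ (by positivity)]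
    exact Nat.le_ceil _

end PathEvaluation

/-! ### Independent random time changes -/

section TimeChange

variable {Ω : Type*} [MeasurableSpace Ω] {P : Measure Ω} [IsProbabilityMeasure P]
  {W : ℝ≥0 → Ω → ℝ}

lemma integrable_timeChange (hW : ∀ t, Measurable (W t))
    (hc : ∀ᵐ ω ∂P, ∀ t, ContinuousWithinAt (fun r => W r ω) (Set.Ici t) t) {T : Ω → ℝ≥0}
    (hT : AEMeasurable T P) (hind : IndepFun (fun ω t => W t ω) T P)
    (hTi : Integrable (fun ω => (T ω : ℝ)) P) (hWi : ∀ t, Integrable (W t) P) {C : ℝ}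
    (hC : ∀ t, ∫ ω, |W t ω| ∂P ≤ C * t) : Integrable (fun ω => W (T ω) ω) P := by
  have hev : ∀ t, (fun ω => pathEval (fun r => W r ω) t) =ᵐ[P] W t := fun t =>
    hc.mono fun ω hω => pathEval_eq (hω t)
  refine (hind.integrable_comp_of_integral_abs_le (measurable_pi_iff.2 hW).aemeasurable hT
    measurable_pathEval (G := fun t => C * t) (fun t => (hWi t).congr (hev t).symm) (fun t => ?_)
    (hTi.const_mul C)).congr (hc.mono fun ω hω => pathEval_eq (hω (T ω)))
  have habs : ∫ ω, |pathEval (fun r => W r ω) t| ∂P = ∫ ω, |W t ω| ∂P :=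
    integral_congr_ae ((hev t).mono fun ω hω => congrArg abs hω)
  exact habs.trans_le (hC t)

lemma integral_timeChange (hW : ∀ t, Measurable (W t))
    (hc : ∀ᵐ ω ∂P, ∀ t, ContinuousWithinAt (fun r => W r ω) (Set.Ici t) t) {T : Ω → ℝ≥0}
    (hT : AEMeasurable T P) (hind : IndepFun (fun ω t => W t ω) T P)
    (hWT : Integrable (fun ω => W (T ω) ω) P) {m : ℝ} (hm : ∀ t, ∫ ω, W t ω ∂P = m * t) :
    ∫ ω, W (T ω) ω ∂P = m * ∫ ω, (T ω : ℝ) ∂P := by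
  have hev : ∀ t, (fun ω => pathEval (fun r => W r ω) t) =ᵐ[P] W t := fun t =>
    hc.mono fun ω hω => pathEval_eq (hω t)
  have hevT : (fun ω => pathEval (fun r => W r ω) (T ω)) =ᵐ[P] fun ω => W (T ω) ω :=
    hc.mono fun ω hω => pathEval_eq (hω (T ω))
  rw [← integral_congr_ae hevT, hind.integral_comp_eq (measurable_pi_iff.2 hW).aemeasurable hT
    measurable_pathEval (g := fun t => m * t) (fun t => ?_) (hWT.congr hevT.symm),
    integral_const_mul]
  rw [integral_congr_ae (hev t), hm]

lemma HasLinearMoments.memLp_timeChange {m v : ℝ} (h : HasLinearMoments W m v P)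
    (hW : ∀ t, Measurable (W t))
    (hc : ∀ᵐ ω ∂P, ∀ t, ContinuousWithinAt (fun r => W r ω) (Set.Ici t) t) {T : Ω → ℝ≥0}
    (hT : AEMeasurable T P) (hind : IndepFun (fun ω t => W t ω) T P)
    (hTL : MemLp (fun ω => (T ω : ℝ)) 2 P) : MemLp (fun ω => W (T ω) ω) 2 P := by
  have hev : ∀ t, (fun ω => pathEval (fun r => W r ω) t) =ᵐ[P] W t := fun t =>
    hc.mono fun ω hω => pathEval_eq (hω t)
  have hevT : (fun ω => pathEval (fun r => W r ω) (T ω)) =ᵐ[P] fun ω => W (T ω) ω :=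
    hc.mono fun ω hω => pathEval_eq (hω (T ω))
  have hmeas : AEMeasurable (fun ω => pathEval (fun r => W r ω) (T ω)) P :=
    aemeasurable_pathEval (measurable_pi_iff.2 hW).aemeasurable hT
  have hTT : Integrable (fun ω => (T ω : ℝ) * T ω) P := hTL.integrable_mul hTL
  have hG : Integrable (fun ω => v * (T ω : ℝ) + m ^ 2 * ((T ω : ℝ) * T ω)) P :=
    ((hTL.integrable one_le_two).const_mul _).add (hTT.const_mul _)
  refine MemLp.ae_eq hevT ((memLp_two_iff_integrable_sq hmeas.aestronglyMeasurable).2 ?_)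
  refine hind.integrable_comp_of_integral_abs_le (measurable_pi_iff.2 hW).aemeasurable hT
    (F := fun z t => pathEval z t ^ 2) (measurable_pathEval.pow_const 2)
    (G := fun t => v * (t : ℝ) + m ^ 2 * ((t : ℝ) * t)) (fun t => ?_) (fun t => ?_) hG
  · exact (h.memLp t).integrable_sq.congr ((hev t).mono fun ω hω => congrArg (· ^ 2) hω.symm)
  · have hsq : ∫ ω, |pathEval (fun r => W r ω) t ^ 2| ∂P = ∫ ω, W t ω * W t ω ∂P :=
      integral_congr_ae ((hev t).mono fun ω hω => by
        simp only [] at hω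
        simp only [hω, abs_of_nonneg (sq_nonneg (W t ω))]
        exact sq _)
    exact (hsq.trans ((h.mul t t le_rfl).trans (by ring))).le

lemma HasLinearMoments.integral_mul_timeChange {m v : ℝ} (h : HasLinearMoments W m v P)
    (hW : ∀ t, Measurable (W t))
    (hc : ∀ᵐ ω ∂P, ∀ t, ContinuousWithinAt (fun r => W r ω) (Set.Ici t) t) {T T' : Ω → ℝ≥0}
    (hT : AEMeasurable T P) (hT' : AEMeasurable T' P) (hTT' : ∀ᵐ ω ∂P, T ω ≤ T' ω)
    (hind : IndepFun (fun ω t => W t ω) (fun ω => (T ω, T' ω)) P)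
    (hTL : MemLp (fun ω => (T ω : ℝ)) 2 P) (hTL' : MemLp (fun ω => (T' ω : ℝ)) 2 P) :
    ∫ ω, W (T ω) ω * W (T' ω) ω ∂P =
      v * ∫ ω, (T ω : ℝ) ∂P + m ^ 2 * ∫ ω, (T ω : ℝ) * T' ω ∂P := by
  have hL := h.memLp_timeChange hW hc hT (hind.comp measurable_id measurable_fst) hTL
  have hL' := h.memLp_timeChange hW hc hT' (hind.comp measurable_id measurable_snd) hTL'
  have hevT : (fun ω => pathEval (fun r => W r ω) (T ω) * pathEval (fun r => W r ω) (T' ω))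
      =ᵐ[P] fun ω => W (T ω) ω * W (T' ω) ω :=
    hc.mono fun ω hω => by simp only [pathEval_eq (hω (T ω)), pathEval_eq (hω (T' ω))]
  have hF : Measurable (Function.uncurry fun (z : ℝ≥0 → ℝ) (p : ℝ≥0 × ℝ≥0) =>
      pathEval z p.1 * pathEval z p.2) :=
    (measurable_pathEval.comp (measurable_fst.prodMk (measurable_fst.comp measurable_snd))).mul
    (measurable_pathEval.comp (measurable_fst.prodMk (measurable_snd.comp measurable_snd)))
  -- Fubini needs the section integral at every pair of times, in either order, hence the `min`; it
  -- becomes `T` since `T ≤ T'` almost surely.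
  rw [← integral_congr_ae hevT, hind.integral_comp_eq (measurable_pi_iff.2 hW).aemeasurable
    (hT.prodMk hT') (F := fun z p => pathEval z p.1 * pathEval z p.2) hF
    (g := fun p => v * (min p.1 p.2 : ℝ≥0) + m ^ 2 * p.1 * p.2) (fun p => ?_)
    ((hL.integrable_mul hL').congr hevT.symm)]
  · have hi : Integrable (fun ω => (T ω : ℝ) * T' ω) P := hTL.integrable_mul hTL'
    rw [← integral_const_mul, ← integral_const_mul,
      ← integral_add ((hTL.integrable one_le_two).const_mul _) (hi.const_mul _)]
    refine integral_congr_ae (hTT'.mono fun ω hω => ?_)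
    simp only [min_eq_left hω]
    ring
  · rw [← h.mul_min]
    exact integral_congr_ae (hc.mono fun ω hω => by
      simp only [pathEval_eq (hω p.1), pathEval_eq (hω p.2)])

/-- The covariance of a process with linear moments, subject to an independent time change. -/
lemma HasLinearMoments.covariance_timeChange {m v : ℝ} (h : HasLinearMoments W m v P)
    (hW : ∀ t, Measurable (W t))
    (hc : ∀ᵐ ω ∂P, ∀ t, ContinuousWithinAt (fun r => W r ω) (Set.Ici t) t) {T T' : Ω → ℝ≥0}
    (hT : AEMeasurable T P) (hT' : AEMeasurable T' P) (hTT' : ∀ᵐ ω ∂P, T ω ≤ T' ω)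
    (hind : IndepFun (fun ω t => W t ω) (fun ω => (T ω, T' ω)) P)
    (hTL : MemLp (fun ω => (T ω : ℝ)) 2 P) (hTL' : MemLp (fun ω => (T' ω : ℝ)) 2 P) :
    cov[fun ω => W (T ω) ω, fun ω => W (T' ω) ω; P] =
      v * ∫ ω, (T ω : ℝ) ∂P + m ^ 2 * cov[fun ω => (T ω : ℝ), fun ω => (T' ω : ℝ); P] := by
  have i1 := hind.comp measurable_id measurable_fst
  have i2 := hind.comp measurable_id measurable_snd
  have hL := h.memLp_timeChange hW hc hT i1 hTL
  have hL' := h.memLp_timeChange hW hc hT' i2 hTL'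
  rw [covariance_eq_sub hL hL', covariance_eq_sub hTL hTL',
    integral_timeChange hW hc hT i1 (hL.integrable one_le_two) h.mean,
    integral_timeChange hW hc hT' i2 (hL'.integrable one_le_two) h.mean]
  simp only [Pi.mul_apply]
  rw [h.integral_mul_timeChange hW hc hT hT' hTT' hind hTL hTL']
  ring

end TimeChange

/-! ### Measurability and second moment of the first exit time -/

section FirstExit

variable {Ω : Type*} {S : ℝ≥0 → Ω → ℝ}

/-- For measurability: on a monotone path the infimum may be taken over rationals. If the level is
never exceeded, `⊤.toNNReal = 0` matches `sInf ∅ = 0`. -/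
lemma firstExit_eq_iInf_rat {ω : Ω} (h : Monotone fun r => S r ω) (t : ℝ≥0) :
    firstExit S t ω = (⨅ q : ℚ, if (t : ℝ) < S (Real.toNNReal q) ω
      then ((Real.toNNReal q : ℝ≥0) : ENNReal) else ⊤).toNNReal := by
  rcases Set.eq_empty_or_nonempty {r : ℝ≥0 | (t : ℝ) < S r ω} with he | hne
  · have h' : ∀ r, ¬ (t : ℝ) < S r ω := fun r hr => by
      have : r ∈ {r : ℝ≥0 | (t : ℝ) < S r ω} := hr
      rw [he] at this
      exact this
    simp [firstExit, h']
  · have key : (⨅ q : ℚ, if (t : ℝ) < S (Real.toNNReal q) ω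
        then ((Real.toNNReal q : ℝ≥0) : ENNReal) else ⊤) = (firstExit S t ω : ENNReal) := by
      refine le_antisymm (le_of_forall_gt fun c hc => ?_) (le_iInf fun q => ?_)
      · obtain ⟨b, hb1, hb2⟩ := ENNReal.lt_iff_exists_nnreal_btwn.1 hc
        obtain ⟨r, hr, hrb⟩ := exists_lt_of_csInf_lt hne (ENNReal.coe_lt_coe.1 hb1)
        obtain ⟨q, -, hrq, hqb⟩ := (NNReal.lt_iff_exists_rat_btwn r b).1 hrb
        refine (iInf_le _ q).trans_lt ?_
        rw [if_pos (hr.trans_le (h hrq.le))]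
        exact (ENNReal.coe_lt_coe.2 hqb).trans hb2
      · split_ifs with hq
        · exact ENNReal.coe_le_coe.2 (csInf_le (OrderBot.bddBelow _) hq)
        · exact le_top
    rw [key, ENNReal.toNNReal_coe]

/-- The level `t` must be exceeded, since otherwise the right side is `sInf ∅ = 0`. -/
lemma firstExit_mono {ω : Ω} {s t : ℝ≥0} (hst : s ≤ t) (h : ∃ r, (t : ℝ) < S r ω) :
    firstExit S s ω ≤ firstExit S t ω :=
  csInf_le_csInf (OrderBot.bddBelow _) h fun _ hr => (NNReal.coe_le_coe.2 hst).trans_lt hr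

lemma le_of_lt_firstExit {ω : Ω} {t r : ℝ≥0} (h : r < firstExit S t ω) : S r ω ≤ t :=
  not_lt.1 fun hr => notMem_of_lt_csInf h (OrderBot.bddBelow _) hr

/-- A pathwise Chernoff bound: `n₀²` is the sum of `2 n + 1` over `n < n₀`, and each such `n` lies
below the exit time, so `S n ≤ t` and the exponential is at least `1`. -/
lemma firstExit_sq_le_tsum (t : ℝ≥0) (ω : Ω) :
    ENNReal.ofReal ((firstExit S t ω : ℝ) ^ 2) ≤
      ∑' n : ℕ, ENNReal.ofReal ((2 * n + 1) * Real.exp (t - S n ω)) := by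
  set n₀ := ⌈firstExit S t ω⌉₊ with hn₀
  have hsq : ∀ j : ℕ, ∑ n ∈ Finset.range j, (2 * (n : ℝ) + 1) = (j : ℝ) ^ 2 := fun j => by
    induction j with
    | zero => simp
    | succ j ih => rw [Finset.sum_range_succ, ih]; push_cast; ring
  have hle : (firstExit S t ω : ℝ) ≤ n₀ := by exact_mod_cast Nat.le_ceil _
  calc ENNReal.ofReal ((firstExit S t ω : ℝ) ^ 2)
      ≤ ENNReal.ofReal (∑ n ∈ Finset.range n₀, (2 * (n : ℝ) + 1) * Real.exp (t - S n ω)) := by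
        refine ENNReal.ofReal_le_ofReal ?_
        calc (firstExit S t ω : ℝ) ^ 2 ≤ (n₀ : ℝ) ^ 2 := by gcongr
          _ = ∑ n ∈ Finset.range n₀, (2 * (n : ℝ) + 1) := (hsq n₀).symm
          _ ≤ _ := Finset.sum_le_sum fun n hn => by
            have := le_of_lt_firstExit (Nat.lt_ceil.1 (Finset.mem_range.1 hn))
            exact le_mul_of_one_le_right (by positivity) (Real.one_le_exp (sub_nonneg.2 this))
    _ = ∑ n ∈ Finset.range n₀, ENNReal.ofReal ((2 * (n : ℝ) + 1) * Real.exp (t - S n ω)) :=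
        ENNReal.ofReal_sum_of_nonneg fun n _ => by positivity
    _ ≤ _ := ENNReal.sum_le_tsum _

variable [MeasurableSpace Ω] {P : Measure Ω}

lemma aemeasurable_firstExit (hS : ∀ t, Measurable (S t))
    (hmono : ∀ᵐ ω ∂P, Monotone fun t => S t ω) (t : ℝ≥0) : AEMeasurable (firstExit S t) P := by
  refine ⟨_, ?_, hmono.mono fun ω hω => firstExit_eq_iInf_rat hω t⟩
  refine (Measurable.iInf fun q => ?_).ennreal_toNNReal
  exact Measurable.ite (measurableSet_lt measurable_const (hS _)) measurable_const measurable_const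

variable [IsProbabilityMeasure P]

/-- Termwise expectation gives `exp t` times the series of `(2 n + 1) exp(-φ)^n`, which converges
since `φ > 0`. -/
lemma lintegral_tsum_exp_lt_top (hS : ∀ t, Measurable (S t)) (hpos : ∀ t, ∀ᵐ ω ∂P, 0 ≤ S t ω)
    {φ : ℝ} (hφ : 0 < φ) (hlap : ∀ n : ℕ, ∫ ω, Real.exp (-S n ω) ∂P = Real.exp (-n * φ))
    (t : ℝ≥0) :
    ∫⁻ ω, ∑' n : ℕ, ENNReal.ofReal ((2 * n + 1) * Real.exp (t - S n ω)) ∂P < ⊤ := by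
  have hm : ∀ n : ℕ, Measurable fun ω => Real.exp (-S n ω) := fun n => (hS n).neg.exp
  have hint : ∀ n : ℕ, Integrable (fun ω => Real.exp (-S n ω)) P := fun n => by
    refine Integrable.of_bound (hm n).aestronglyMeasurable 1 ?_
    filter_upwards [hpos n] with ω hω
    simpa using hω
  have heq : ∀ (n : ℕ) (ω : Ω), (2 * (n : ℝ) + 1) * Real.exp (t - S n ω) =
      (2 * (n : ℝ) + 1) * Real.exp t * Real.exp (-S n ω) := fun n ω => by
    rw [sub_eq_add_neg, Real.exp_add, mul_assoc]
  simp_rw [heq]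
  rw [lintegral_tsum fun n => ((hm n).const_mul _).ennreal_ofReal.aemeasurable]
  have hterm : ∀ n : ℕ, ∫⁻ ω, ENNReal.ofReal ((2 * (n : ℝ) + 1) * Real.exp t * Real.exp (-S n ω)) ∂P
      = ENNReal.ofReal (Real.exp t * ((2 * (n : ℝ) + 1) * Real.exp (-φ) ^ n)) := fun n => by
    rw [← ofReal_integral_eq_lintegral_ofReal ((hint n).const_mul _)
      (Eventually.of_forall fun ω => by positivity), integral_const_mul, hlap, ← Real.exp_nat_mul]
    congr 1
    rw [mul_neg, neg_mul]
    ring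
  simp_rw [hterm]
  have hx : ‖Real.exp (-φ)‖ < 1 := by
    rw [Real.norm_of_nonneg (Real.exp_pos _).le, Real.exp_lt_one_iff]
    linarith
  have hsum : Summable fun n : ℕ => Real.exp t * ((2 * (n : ℝ) + 1) * Real.exp (-φ) ^ n) := by
    refine Summable.mul_left _ ?_
    have h1 := summable_pow_mul_geometric_of_norm_lt_one 1 hx
    have h0 := summable_geometric_of_norm_lt_one hx
    refine ((h1.mul_left 2).add h0).congr fun n => ?_
    ring
  exact hsum.tsum_ofReal_lt_top

lemma ae_exists_lt_of_laplace (hS : ∀ t, Measurable (S t)) (hpos : ∀ t, ∀ᵐ ω ∂P, 0 ≤ S t ω)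
    {φ : ℝ} (hφ : 0 < φ) (hlap : ∀ n : ℕ, ∫ ω, Real.exp (-S n ω) ∂P = Real.exp (-n * φ))
    (t : ℝ≥0) : ∀ᵐ ω ∂P, ∃ r, (t : ℝ) < S r ω := by
  have hm : Measurable fun ω => ∑' n : ℕ, ENNReal.ofReal ((2 * n + 1) * Real.exp (t - S n ω)) :=
    Measurable.tsum fun n => by have := hS n; fun_prop
  filter_upwards [ae_lt_top hm (lintegral_tsum_exp_lt_top hS hpos hφ hlap t).ne] with ω hω
  -- On a path bounded by `t` every term of the series is at least `1`, so the series would diverge.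
  by_contra! hle
  refine hω.ne (top_unique ?_)
  rw [← ENNReal.tsum_const_eq_top_of_ne_zero (α := ℕ) one_ne_zero]
  refine ENNReal.tsum_le_tsum fun n => ?_
  rw [← ENNReal.ofReal_one]
  refine ENNReal.ofReal_le_ofReal ?_
  have h1 : 1 ≤ Real.exp (t - S n ω) := Real.one_le_exp (sub_nonneg.2 (hle n))
  have h2 : (0 : ℝ) ≤ n := n.cast_nonneg
  nlinarith

lemma memLp_firstExit (hS : ∀ t, Measurable (S t)) (hmono : ∀ᵐ ω ∂P, Monotone fun t => S t ω)
    (hpos : ∀ t, ∀ᵐ ω ∂P, 0 ≤ S t ω)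
    {φ : ℝ} (hφ : 0 < φ) (hlap : ∀ n : ℕ, ∫ ω, Real.exp (-S n ω) ∂P = Real.exp (-n * φ))
    (t : ℝ≥0) : MemLp (fun ω => (firstExit S t ω : ℝ)) 2 P := by
  have hE : AEMeasurable (fun ω => (firstExit S t ω : ℝ)) P :=
    (aemeasurable_firstExit hS hmono t).coe_nnreal_real
  rw [memLp_two_iff_integrable_sq hE.aestronglyMeasurable]
  refine ⟨(hE.pow_const 2).aestronglyMeasurable, ?_⟩
  rw [hasFiniteIntegral_iff_ofReal (Eventually.of_forall fun ω => by positivity)]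
  exact (lintegral_mono fun ω => firstExit_sq_le_tsum t ω).trans_lt
    (lintegral_tsum_exp_lt_top hS hpos hφ hlap t)

end FirstExit

/-! ### The mixture of tempered stable subordinators and the paths of `Z` -/

section MTSS

variable {Ω : Type*} [MeasurableSpace Ω] {P : Measure Ω}

lemma mtssExponent_pos {c₁ c₂ α₁ α₂ μ₁ μ₂ s : ℝ} (hc : c₁ + c₂ = 1) (hc₁ : 0 ≤ c₁)
    (hc₂ : 0 ≤ c₂) (hα₁ : 0 < α₁) (hα₂ : 0 < α₂) (hμ₁ : 0 < μ₁) (hμ₂ : 0 < μ₂) (hs : 0 < s) :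
    0 < mtssExponent c₁ c₂ α₁ α₂ μ₁ μ₂ s := by
  have h1 : 0 < (s + μ₁) ^ α₁ - μ₁ ^ α₁ :=
    sub_pos.2 (Real.rpow_lt_rpow hμ₁.le (by linarith) hα₁)
  have h2 : 0 < (s + μ₂) ^ α₂ - μ₂ ^ α₂ :=
    sub_pos.2 (Real.rpow_lt_rpow hμ₂.le (by linarith) hα₂)
  unfold mtssExponent
  rcases hc₁.eq_or_lt with h | h
  · have : c₂ = 1 := by linarith
    rw [← h, this]
    linarith
  · have := mul_pos h h1
    have := mul_nonneg hc₂ h2.le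
    linarith

lemma IsSubordinator.ae_nonneg {S : ℝ≥0 → Ω → ℝ} (h : IsSubordinator S P) (t : ℝ≥0) :
    ∀ᵐ ω ∂P, 0 ≤ S t ω := by
  filter_upwards [h.zero, h.monotone] with ω h0 hm
  rw [← h0]
  exact hm zero_le

lemma IsMTSS.integral_exp_neg_natCast {c₁ c₂ α₁ α₂ μ₁ μ₂ : ℝ} {S : ℝ≥0 → Ω → ℝ}
    (h : IsMTSS c₁ c₂ α₁ α₂ μ₁ μ₂ S P) (n : ℕ) :
    ∫ ω, Real.exp (-S n ω) ∂P = Real.exp (-n * mtssExponent c₁ c₂ α₁ α₂ μ₁ μ₂ 1) := by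
  simpa using h.laplace n 1 one_pos

/-- The paths of `cppok N X Y` depend on time through those of `N`, which are step functions. -/
lemma IsCPPoK.ae_continuousWithinAt {k : ℕ} {lam : ℝ≥0} {H : StieltjesFunction ℝ}
    {N : ℝ≥0 → Ω → ℕ} {X : ℕ → Ω → ℕ} {Y : ℕ → Ω → ℝ} (h : IsCPPoK k lam H N X Y P) :
    ∀ᵐ ω ∂P, ∀ t, ContinuousWithinAt (fun r => cppok N X Y r ω) (Set.Ici t) t := by
  filter_upwards [h.isPPoK.poisson.levy.cadlag] with ω hω t
  -- `ℕ` is discrete in `ℝ`, so right continuity of the real-valued path is convergence in `ℕ`,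
  -- where every function is continuous.
  have h1 : Tendsto (fun r => N r ω) (𝓝[≥] t) (𝓝 (N t ω)) :=
    Nat.isClosedEmbedding_coe_real.isInducing.tendsto_nhds_iff.2 (hω t).1
  have h2 : Tendsto (fun n => ∑ i ∈ Finset.range (∑ j ∈ Finset.range n, X j ω), Y i ω)
      (𝓝 (N t ω)) (𝓝 (cppok N X Y t ω)) := continuous_of_discreteTopology.tendsto _
  exact h2.comp h1

end MTSS

theorem mainTheorem6 {Ω : Type*} [MeasurableSpace Ω] (P : Measure Ω) [IsProbabilityMeasure P]
    (k : ℕ) (hk : 1 ≤ k) (lam : ℝ≥0) (hlam : 0 < lam) (H : StieltjesFunction ℝ)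
    (N : ℝ≥0 → Ω → ℕ) (X : ℕ → Ω → ℕ) (Y : ℕ → Ω → ℝ) (hZ : IsCPPoK k lam H N X Y P)
    (c₁ c₂ α₁ α₂ μ₁ μ₂ : ℝ) (hc : c₁ + c₂ = 1) (hc₁ : 0 ≤ c₁) (hc₂ : 0 ≤ c₂)
    (hα₁ : α₁ ∈ Set.Ioo (0 : ℝ) 1) (hα₂ : α₂ ∈ Set.Ioo (0 : ℝ) 1) (hμ₁ : 0 < μ₁) (hμ₂ : 0 < μ₂)
    (S : ℝ≥0 → Ω → ℝ) (hS : IsMTSS c₁ c₂ α₁ α₂ μ₁ μ₂ S P)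
    (hindep : IndepFun (fun ω t => cppok N X Y t ω) (fun ω t => firstExit S t ω) P)
    (hY : Integrable (Y 0) P) :
    (∀ t : ℝ≥0,
      Integrable (fun ω => (firstExit S t ω : ℝ)) P ∧
      Integrable (tcppok N X Y S t) P ∧
      ∫ ω, tcppok N X Y S t ω ∂P =
        (k : ℝ) * (k + 1) / 2 * lam * (∫ ω, Y 0 ω ∂P) * ∫ ω, (firstExit S t ω : ℝ) ∂P) ∧
    (MemLp (Y 0) 2 P →
      MemLp (cppok N X Y 1) 2 P ∧
      (∀ t : ℝ≥0, MemLp (fun ω => (firstExit S t ω : ℝ)) 2 P ∧ MemLp (tcppok N X Y S t) 2 P) ∧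
      ∀ s t : ℝ≥0, s ≤ t →
        cov[tcppok N X Y S s, tcppok N X Y S t; P] =
          Var[cppok N X Y 1; P] * (∫ ω, (firstExit S s ω : ℝ) ∂P) +
            (∫ ω, cppok N X Y 1 ω ∂P) ^ 2 *
              cov[fun ω => (firstExit S s ω : ℝ), fun ω => (firstExit S t ω : ℝ); P]) := by
  have hWm := hZ.measurable
  have hWc := hZ.ae_continuousWithinAt
  have hφ := mtssExponent_pos hc hc₁ hc₂ hα₁.1 hα₂.1 hμ₁ hμ₂ one_pos
  have hpos := hS.toIsSubordinator.ae_nonneg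
  have hlap := hS.integral_exp_neg_natCast
  have hE : ∀ t, AEMeasurable (firstExit S t) P := aemeasurable_firstExit hS.measurable hS.monotone
  have hEL : ∀ t, MemLp (fun ω => (firstExit S t ω : ℝ)) 2 P :=
    memLp_firstExit hS.measurable hS.monotone hpos hφ hlap
  have hind : ∀ t, IndepFun (fun ω r => cppok N X Y r ω) (firstExit S t) P := fun t =>
    hindep.comp measurable_id (measurable_pi_apply t)
  refine ⟨fun t => ?_, fun hL => ?_⟩
  · have hi : Integrable (tcppok N X Y S t) P :=
      integrable_timeChange hWm hWc (hE t) (hind t) ((hEL t).integrable one_le_two)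
        (hZ.integrable hk hY) (hZ.integral_abs_le hk hY)
    exact ⟨(hEL t).integrable one_le_two, hi,
      integral_timeChange hWm hWc (hE t) (hind t) hi (hZ.integral_eq hk hY)⟩
  · obtain ⟨v, hv⟩ := hZ.hasLinearMoments hk hL
    refine ⟨hv.memLp 1, fun t => ⟨hEL t, hv.memLp_timeChange hWm hWc (hE t) (hind t) (hEL t)⟩,
      fun s t hst => ?_⟩
    have hmono : ∀ᵐ ω ∂P, firstExit S s ω ≤ firstExit S t ω := by
      filter_upwards [ae_exists_lt_of_laplace hS.measurable hpos hφ hlap t] with ω hω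
      exact firstExit_mono hst hω
    -- This identifies `v` with `Var[Z(1)]` and the slope of the mean with `E[Z(1)]`.
    rw [hv.variance_one, hv.mean 1, NNReal.coe_one, mul_one]
    exact hv.covariance_timeChange hWm hWc (hE s) (hE t) hmono
      (hindep.comp measurable_id ((measurable_pi_apply s).prodMk (measurable_pi_apply t)))
      (hEL s) (hEL t)
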